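/- Let $q\ge 0$ and $T\ge q+1$ be integers, and consider the earnings model $$y_t=v_t+w_t,\qquad v_t=\eta_1+\dots+\eta_t,\qquad w_t=\xi_t+a_1\xi_{t-1}+\dots+a_q\xi_{t-q},\qquad t=1,\dots,T,$$ with real coefficients $a_1,\dots,a_q$ and real random variables $\xi_{1-q},\dots,\xi_T,\eta_1,\dots,\eta_T$ such that $\xi_{1-q},\dots,\xi_0,(\xi_1,\eta_1),\dots,(\xi_T,\eta_T)$ are mutually independent. Only the joint distribution of $(y_1,\dots,y_T)$ is observed. Suppose in addition that $\eta_1$ and $\xi_1$ are independent, that $\xi_1$ is nongaussian (constants count as degenerate gaussian random variables), and that $a_q\ne 0$ (where $a_0=1$). Then $a_1,\dots,a_q$ are identified within the class of models that satisfy all these assumptions: if $(\tilde a_1,\dots,\tilde a_q,\tilde\xi_{1-q},\dots,\tilde\xi_T,\tilde\eta_1,\dots,\tilde\eta_T)$ is another such model, possibly on a different probability space, and it generates the same joint distribution of $(y_1,\dots,y_T)$, then $\tilde a_j=a_j$ for $j=1,\dots,q$. -/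

import Mathlib

open MeasureTheory ProbabilityTheory

universe u v

/-- The earnings dynamics model with `T` periods and a transitory component that is `MA(q)`:
the coefficients `a_1, …, a_q` and the unobserved shocks, which are random variables on some
probability space. Times are integers; only `ξ_{1-q}, …, ξ_T` and `η_1, …, η_T` are part of the
model, the values of `ξ` and `η` at other times are irrelevant. -/
structure EDModel (q T : ℕ) where
  /-- the sample space -/
  Ω : Type u
  [mΩ : MeasurableSpace Ω]
  /-- the probability -/
  P : Measure Ω
  [isProb : IsProbabilityMeasure P]
  /-- the coefficients; the coefficient `a_j` is `a ⟨j - 1, _⟩` for `1 ≤ j ≤ q` -/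
  a : Fin q → ℝ
  /-- transitory shocks -/
  ξ : ℤ → Ω → ℝ
  /-- permanent shocks -/
  η : ℤ → Ω → ℝ
  measurable_ξ : ∀ t ∈ Finset.Icc (1 - (q : ℤ)) T, Measurable (ξ t)
  measurable_η : ∀ t ∈ Finset.Icc (1 : ℤ) T, Measurable (η t)
  /-- `ξ_{1-q}, …, ξ_0, (ξ_1, η_1), …, (ξ_T, η_T)` are mutually independent. In order to have all
  blocks of the same type, a block `ξ_t` with `t ≤ 0` is written as the pair `(ξ_t, 0)`. -/
  indep : iIndepFun
    (fun (t : Finset.Icc (1 - (q : ℤ)) (T : ℤ)) (ω : Ω) =>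
      ((ξ t ω, if 1 ≤ (t : ℤ) then η t ω else 0) : ℝ × ℝ)) P

namespace EDModel

attribute [instance] EDModel.mΩ EDModel.isProb

variable {q T : ℕ}

/-- The coefficient of `ξ_{t-j}` in `w_t`: it is `1` for `j = 0`, `a_j` for `1 ≤ j ≤ q`, and `0`
for `j > q`. -/
def coeff (M : EDModel q T) : ℕ → ℝ
  | 0 => 1
  | j + 1 => if h : j < q then M.a ⟨j, h⟩ else 0

/-- The permanent component `v_t = η_1 + … + η_t`. -/
noncomputable def permanent (M : EDModel q T) (t : ℤ) (ω : M.Ω) : ℝ :=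
  ∑ s ∈ Finset.Icc 1 t, M.η s ω

/-- The transitory component `w_t = a_q ξ_{t-q} + … + a_1 ξ_{t-1} + ξ_t`. -/
noncomputable def transitory (M : EDModel q T) (t : ℤ) (ω : M.Ω) : ℝ :=
  ∑ j ∈ Finset.range (q + 1), M.coeff j * M.ξ (t - (j : ℤ)) ω

/-- Log earnings (net of covariates) `y_t = v_t + w_t`. -/
noncomputable def income (M : EDModel q T) (t : ℤ) (ω : M.Ω) : ℝ :=
  M.permanent t ω + M.transitory t ω

/-- The distribution of the observed vector `(y_1, …, y_T)`. -/
noncomputable def observedLaw (M : EDModel q T) : Measure (Fin T → ℝ) :=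
  M.P.map (fun ω (i : Fin T) => M.income ((i : ℤ) + 1) ω)

/-- Two models are observationally equivalent if they generate the same distribution of the
observed vector. -/
def ObsEquiv (M N : EDModel q T) : Prop :=
  M.observedLaw = N.observedLaw

/-- The maintained restrictions: `η_1` and `ξ_1` are independent, `ξ_1` is nongaussian, and
`a_q ≠ 0`. Constants count as (degenerate) gaussian random variables. -/
structure Admissible (M : EDModel q T) : Prop where
  indepFun : IndepFun (M.η 1) (M.ξ 1) M.P
  nongaussian : ¬ HasGaussianLaw (M.ξ 1) M.P
  coeff_ne_zero : M.coeff q ≠ 0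

/-- The coefficients `a_1, …, a_q` of `M` are identified (within the class of admissible models):
every admissible model, on whatever probability space, that is observationally equivalent to `M`
has the same coefficients. -/
def CoeffsIdentified (M : EDModel.{u} q T) : Prop :=
  ∀ N : EDModel.{v} q T, N.Admissible → ObsEquiv M N → ∀ j : Fin q, N.a j = M.a j

end EDModel

/-! By independence, the characteristic function of `(y_1, …, y_T)` is a product over dates. The
date 1 factor is `φ (s ⬝ᵥ α) * ψ (s ⬝ᵥ β)`, where `α = (1, a_1, …, a_q, 0, …)`, `β = (1, …, 1)`, and
`φ`, `ψ` belong to `ξ_1`, `η_1`. Factors of dates at least 2 do not involve `s_1`; those of dates at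
most 0 do not involve `s_{q+1}`.

Equate the factorizations of two equivalent models with `α ≠ α'` and take logarithms near 0. If `α ≠
β`, then `log φ (s ⬝ᵥ α)` is a sum of four functions, each invariant along a direction not
orthogonal to `α`. Differencing along all four directions kills the sum, so `log φ` has vanishing
fourth differences and is a cubic near 0 (`exists_eq_exp_cubic_of_mul_eq`).

A cubic form of Marcinkiewicz's theorem (`isGaussian_of_charFun_eventuallyEq_exp_cubic`) then makes
`ξ_1` gaussian, a contradiction. If `α` and `α'` differ at a coordinate, one of them differs from 1
there, and the argument is run with that model first. -/

open Filter Topology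

/-! ### Functions with vanishing fourth differences -/

/-- A continuous function on `[0, 3]` whose fourth differences vanish is zero if it vanishes at
`0, 1, 2, 3`. -/
theorem eq_zero_of_fourth_diff_eq_zero {F : ℝ → ℂ} (hc : ContinuousOn F (Set.Icc 0 3))
    (hd : ∀ x h : ℝ, 0 ≤ x → 0 ≤ h → x + 4 * h ≤ 3 →
      F x - 4 * F (x + h) + 6 * F (x + 2 * h) - 4 * F (x + 3 * h) + F (x + 4 * h) = 0)
    (hF : ∀ k : ℕ, k ≤ 3 → F k = 0) {x : ℝ} (hx : x ∈ Set.Icc (0 : ℝ) 3) : F x = 0 := by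
  -- Halve the mesh repeatedly: zeros on one dyadic grid propagate to its midpoints, and dyadic
  -- points are dense.
  have key : ∀ n k : ℕ, k ≤ 3 * 2 ^ n → F (k / 2 ^ n) = 0 := by
    intro n
    induction n with
    | zero => intro k hk; simpa using hF k (by simpa using hk)
    | succ n ih =>
      intro k hk
      have h2 : (0 : ℝ) < 2 ^ n := by positivity
      obtain ⟨m, rfl | rfl⟩ := Nat.even_or_odd' k
      · have := ih m (by rw [pow_succ] at hk; omega)
        convert this using 2
        push_cast
        rw [pow_succ]; field_simp
      · set N := 2 ^ n with hN
        have hN1 : 1 ≤ N := Nat.one_le_two_pow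
        have hmk : m + 1 ≤ 3 * N := by rw [pow_succ] at hk; omega
        -- The old grid points `j, …, j + 3` form a window around the midpoint of `m` and `m + 1`;
        -- the minimum keeps it inside `[0, 3 * N]`.
        obtain ⟨j, hj1, hj2, hj3⟩ : ∃ j, j ≤ m ∧ m ≤ j + 2 ∧ j + 3 ≤ 3 * N := by
          refine ⟨min m (3 * N - 3), ?_, ?_, ?_⟩ <;> omega
        have hNr : (N : ℝ) = 2 ^ n := by simp [hN]
        have hj3' : (j : ℝ) + 3 ≤ 3 * 2 ^ n := by rw [← hNr]; exact_mod_cast hj3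
        have hj0 : (0 : ℝ) ≤ j := by positivity
        set h : ℝ := 1 / 2 ^ (n + 1) with hh
        have hhpos : 0 < h := by positivity
        have hh2 : h * 2 ^ n * 2 = 1 := by rw [hh, pow_succ]; field_simp
        set y : ℝ := j / 2 ^ n with hy
        have hy' : y = 2 * j * h := by rw [hh, hy, pow_succ]; field_simp
        have hy0 : 0 ≤ y := by positivity
        have hy3 : y + 6 * h ≤ 3 := by
          rw [hy']; nlinarith
        -- With the old grid values zero, the three midpoint values satisfy `o1 + o2 = 0`, `o1 + 6 *
        -- o2 + o3 = 0` and `o2 + o3 = 0`, a nonsingular system.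
        have e0 := hd y h hy0 hhpos.le (by linarith)
        have e1 := hd (y + h) h (by linarith) hhpos.le (by linarith)
        have e2 := hd (y + 2 * h) h (by linarith) hhpos.le (by linarith)
        have z0 : F y = 0 := ih j (by omega)
        have z (i : ℕ) (hi : i ≤ 3) : F (y + 2 * i * h) = 0 := by
          have := ih (j + i) (by omega)
          convert this using 2
          rw [hy', hh, pow_succ]; push_cast; field_simp
        have z1 := z 1 (by norm_num)
        have z2 := z 2 (by norm_num)
        have z3 := z 3 (by norm_num)
        norm_num at z1 z2 z3
        ring_nf at e0 e1 e2 z0 z1 z2 z3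
        rw [z0, z1, z2] at e0
        rw [z1, z2] at e1
        rw [z1, z2, z3] at e2
        have o2 : F (y + h * 3) = 0 := by linear_combination (-e0 / 4 - e1 - e2 / 4) / (-4)
        have o1 : F (y + h) = 0 := by linear_combination -o2 - e0 / 4
        have o3 : F (y + h * 5) = 0 := by linear_combination -o2 - e2 / 4
        obtain rfl | rfl | rfl : m = j ∨ m = j + 1 ∨ m = j + 2 := by omega
        · convert o1 using 2; rw [hy', hh]; push_cast; field_simp
        · convert o2 using 2; rw [hy', hh]; push_cast; field_simp; ring
        · convert o3 using 2; rw [hy', hh]; push_cast; field_simp; ring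
  have hlim : Tendsto (fun n : ℕ ↦ ((⌊x * 2 ^ n⌋₊ : ℝ) / 2 ^ n)) atTop (𝓝 x) :=
    (tendsto_nat_floor_mul_div_atTop hx.1).comp
      (tendsto_pow_atTop_atTop_of_one_lt (r := (2 : ℝ)) (by norm_num))
  have hfl (n : ℕ) : ⌊x * 2 ^ n⌋₊ ≤ 3 * 2 ^ n := by
    refine Nat.floor_le_of_le ?_
    push_cast
    have := hx.2
    gcongr
  have hmem (n : ℕ) : ((⌊x * 2 ^ n⌋₊ : ℝ) / 2 ^ n) ∈ Set.Icc (0 : ℝ) 3 := by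
    refine ⟨by positivity, ?_⟩
    rw [div_le_iff₀ (by positivity)]
    exact_mod_cast hfl n
  have := (hc x hx).tendsto.comp (tendsto_nhdsWithin_iff.2 ⟨hlim, .of_forall hmem⟩)
  refine tendsto_nhds_unique this ?_
  simp only [Function.comp_def, key _ _ (hfl _)]
  exact tendsto_const_nhds

/-- A function that is continuous near `0` and whose fourth differences vanish near `0` is
a cubic polynomial near `0`. -/
theorem exists_cubic_of_fourth_diff_eq_zero {l : ℝ → ℂ} (h0 : l 0 = 0)
    (hc : ∀ᶠ t in 𝓝 0, ContinuousAt l t)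
    (hd : ∀ᶠ p : ℝ × ℝ in 𝓝 0, l p.1 - 4 * l (p.1 + p.2) + 6 * l (p.1 + 2 * p.2)
      - 4 * l (p.1 + 3 * p.2) + l (p.1 + 4 * p.2) = 0) :
    ∃ a b c : ℂ, ∀ᶠ t : ℝ in 𝓝 0, l t = a * t + b * t ^ 2 + c * t ^ 3 := by
  obtain ⟨r, hr, hr'⟩ := Metric.eventually_nhds_iff.1 hc
  obtain ⟨s, hs, hs'⟩ := Metric.eventually_nhds_iff.1 hd
  simp only [Prod.forall, dist_zero_right, Real.norm_eq_abs, Prod.norm_mk, sup_lt_iff] at hr' hs'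
  set L := min r s / 4 with hL
  have hLr : 4 * L ≤ r := by have := min_le_left r s; linarith
  have hLs : 4 * L ≤ s := by have := min_le_right r s; linarith
  have hL0 : 0 < L := by positivity
  -- These coefficients, in the variable `t / L`, interpolate `l` at `-L, 0, L, 2 * L`; `F` is the
  -- error, transported to `[0, 3]`.
  set c : ℂ := (l (2 * L) - l (-L) - 3 * l L) / 6 with hcdef
  set b : ℂ := (l (-L) + l L) / 2 with hb
  set a : ℂ := (l L - l (-L)) / 2 - c with ha
  set F : ℝ → ℂ := fun y ↦ l (L * (y - 1)) -
    (a * ((y - 1 : ℝ) : ℂ) + b * ((y - 1 : ℝ) : ℂ) ^ 2 + c * ((y - 1 : ℝ) : ℂ) ^ 3) with hF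
  have hzero (y : ℝ) (hy : y ∈ Set.Icc (0 : ℝ) 3) : F y = 0 := by
    refine eq_zero_of_fourth_diff_eq_zero ?_ ?_ ?_ hy
    · intro z hz
      refine ContinuousAt.continuousWithinAt ?_
      refine ContinuousAt.sub ?_ (by fun_prop)
      have : ContinuousAt l (L * (z - 1)) := by
        refine hr' ?_
        rw [abs_lt]
        constructor <;> nlinarith [hz.1, hz.2]
      exact ContinuousAt.comp (f := fun z : ℝ ↦ L * (z - 1)) this (by fun_prop)
    · intro x h hx hh hxh
      have := hs' (L * (x - 1)) (L * h)
        ⟨by rw [abs_lt]; constructor <;> nlinarith, by rw [abs_lt]; constructor <;> nlinarith⟩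
      simp only [hF]
      push_cast
      rw [show L * (x + h - 1) = L * (x - 1) + L * h by ring,
        show L * (x + 2 * h - 1) = L * (x - 1) + 2 * (L * h) by ring,
        show L * (x + 3 * h - 1) = L * (x - 1) + 3 * (L * h) by ring,
        show L * (x + 4 * h - 1) = L * (x - 1) + 4 * (L * h) by ring]
      linear_combination this
    · intro k hk
      simp only [hF]
      interval_cases k
      · norm_num [ha, hb]; ring
      · norm_num [h0]
      · norm_num [ha, hb]; ring
      · norm_num [ha, hb, hcdef, mul_comm L 2]; ring
  refine ⟨a / L, b / L ^ 2, c / L ^ 3, ?_⟩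
  filter_upwards [Metric.ball_mem_nhds (0 : ℝ) hL0] with t ht
  rw [Metric.mem_ball, dist_zero_right, Real.norm_eq_abs, abs_lt] at ht
  have hLC : (L : ℂ) ≠ 0 := by exact_mod_cast hL0.ne'
  have := hzero (t / L + 1) ⟨by
      have : -1 ≤ t / L := by rw [le_div_iff₀ hL0]; linarith
      linarith, by
      have : t / L ≤ 1 := by rw [div_le_iff₀ hL0]; linarith
      linarith⟩
  simp only [hF, add_sub_cancel_right] at this
  rw [mul_div_cancel₀ _ hL0.ne'] at this
  rw [sub_eq_zero.1 this]
  push_cast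
  field_simp

/-- If a cubic polynomial without constant term is nonpositive, its odd coefficients vanish. -/
theorem cubic_coeff_of_nonpos {A B C : ℝ} (h : ∀ y : ℝ, A * y + B * y ^ 2 + C * y ^ 3 ≤ 0) :
    A = 0 ∧ B ≤ 0 ∧ C = 0 := by
  -- Combine the inequalities at `y` and `-y` and divide by `y`. Letting `y → 0` gives `A = 0`; a
  -- large `y` then gives `C = 0`.
  have hle (y : ℝ) (hy : 0 < y) : |A + C * y ^ 2| ≤ -B * y := by
    rw [abs_le]
    have h1 := h y
    have h2 := h (-y)
    constructor
    · by_contra hlt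
      nlinarith [mul_lt_mul_of_pos_right (not_le.1 hlt) hy]
    · by_contra hlt
      nlinarith [mul_lt_mul_of_pos_right (not_le.1 hlt) hy]
  have hA : A = 0 := by
    have t1 : Tendsto (fun y : ℝ ↦ |A + C * y ^ 2|) (𝓝[>] 0) (𝓝 |A|) := by
      have : Continuous fun y : ℝ ↦ |A + C * y ^ 2| := by fun_prop
      simpa using (this.tendsto 0).mono_left nhdsWithin_le_nhds
    have t2 : Tendsto (fun y : ℝ ↦ -B * y) (𝓝[>] 0) (𝓝 0) := by
      have : Continuous fun y : ℝ ↦ -B * y := by fun_prop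
      simpa using (this.tendsto 0).mono_left nhdsWithin_le_nhds
    have := le_of_tendsto_of_tendsto t1 t2 (eventually_mem_nhdsWithin.mono hle)
    exact abs_nonpos_iff.1 this
  subst hA
  have hB : B ≤ 0 := by
    have := (abs_nonneg _).trans (hle 1 one_pos)
    linarith
  refine ⟨rfl, hB, ?_⟩
  by_contra hC
  have hCp : 0 < |C| := abs_pos.2 hC
  have h1 := hle ((-B + 1) / |C|) (by apply div_pos <;> linarith)
  have hyp : 0 < (-B + 1) / |C| := by apply div_pos <;> linarith
  rw [zero_add, abs_mul, abs_pow, abs_of_pos hyp, pow_two, ← mul_assoc] at h1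
  have := le_of_mul_le_mul_right h1 hyp
  rw [mul_div_cancel₀ _ hCp.ne'] at this
  linarith

/-! ### Moments from smoothness of the characteristic function -/

section Moments

variable {μ : Measure ℝ} [IsFiniteMeasure μ]

/-- The integrand is nonnegative and, divided by `h ^ 2`, tends to `x ^ 2`, so second differences of
the characteristic function control the second moment. -/
theorem integral_one_sub_cos_eq_charFun (h : ℝ) :
    ∫ x : ℝ, (2 - 2 * Real.cos (h * x)) ∂μ
      = (2 * charFun μ 0 - charFun μ h - charFun μ (-h)).re := by
  have hint (t : ℝ) : Integrable (fun x : ℝ ↦ Complex.exp (t * x * Complex.I)) μ := by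
    refine Integrable.of_bound (C := 1) (by fun_prop) (.of_forall fun x ↦ ?_)
    rw [← Complex.ofReal_mul, Complex.norm_exp_ofReal_mul_I]
  simp only [charFun_apply_real]
  have h01 := ((hint 0).const_mul 2).sub' (hint h)
  rw [← integral_const_mul, ← integral_sub ((hint 0).const_mul 2) (hint h),
    ← integral_sub h01 (hint (-h)), ← RCLike.re_eq_complex_re, ← integral_re (h01.sub' (hint (-h)))]
  congr with x
  simp only [RCLike.re_eq_complex_re, Complex.sub_re, ← Complex.ofReal_mul,
    Complex.exp_ofReal_mul_I_re]
  simp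
  ring

/-- The second difference vanishes at `h = 0` together with its first derivative, so Taylor's
formula leaves only a quadratic remainder. -/
theorem exists_second_diff_bound {g : ℝ → ℂ} (hg : ContDiff ℝ 2 g) :
    ∃ C : ℝ, ∀ h ∈ Set.Icc (0 : ℝ) 1, ‖2 * g 0 - g h - g (-h)‖ ≤ C * h ^ 2 := by
  set f : ℝ → ℂ := fun h ↦ 2 * g 0 - g h - g (-h) with hf
  have hf2 : ContDiff ℝ 2 f := by fun_prop
  obtain ⟨C, hC⟩ := exists_taylor_mean_remainder_bound (f := f) (n := 1) (zero_le_one (α := ℝ))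
    (by norm_num; exact hf2.contDiffOn)
  refine ⟨C, fun h hh ↦ ?_⟩
  have hdg : Differentiable ℝ g := hg.differentiable (by norm_num)
  have hderiv : HasDerivAt f 0 0 := by
    have h1 := (hdg 0).hasDerivAt
    have h2 : HasDerivAt (fun h ↦ g (-h)) (-deriv g 0) 0 := by
      have h1' : HasDerivAt g (deriv g 0) (-(0 : ℝ)) := by simpa using h1
      simpa [Function.comp_def] using h1'.scomp (0 : ℝ) (hasDerivAt_neg (0 : ℝ))
    convert! ((hasDerivAt_const (0 : ℝ) (2 * g 0)).sub h1).sub h2 using 1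
    ring
  have hz : taylorWithinEval f 1 (Set.Icc 0 1) 0 h = 0 := by
    rw [taylorWithinEval_succ, taylor_within_zero_eval, zero_add, iteratedDerivWithin_one,
      hderiv.hasDerivWithinAt.derivWithin (uniqueDiffOn_Icc zero_lt_one 0 (by simp))]
    simp [hf]
    ring
  have := hC h hh
  rw [hz] at this
  simpa using this

/-- If the characteristic function is twice continuously differentiable near `0`, then the second
moment is finite. -/
theorem integrable_sq_of_charFun_eventuallyEq {g : ℝ → ℂ} (hg : ContDiff ℝ 2 g)
    (h : charFun μ =ᶠ[𝓝 0] g) : Integrable (fun x ↦ x ^ 2) μ := by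
  obtain ⟨C, hC⟩ := exists_second_diff_bound hg
  set a : ℕ → ℝ := fun n ↦ 1 / ((n : ℝ) + 1) with ha
  have ha0 : Tendsto a atTop (𝓝 0) := tendsto_one_div_add_atTop_nhds_zero_nat
  have hapos (n) : 0 < a n := by positivity
  set f : ℕ → ℝ → ℝ := fun n x ↦ (2 - 2 * Real.cos (a n * x)) / a n ^ 2 with hf
  have hf0 (n x) : 0 ≤ f n x := by
    have := Real.cos_le_one (a n * x)
    exact div_nonneg (by linarith) (sq_nonneg _)
  have hlim (x : ℝ) : Tendsto (fun n ↦ f n x) atTop (𝓝 (x ^ 2)) := by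
    have hs : Tendsto (fun n ↦ (x * Real.sinc (a n * x / 2)) ^ 2) atTop (𝓝 ((x * 1) ^ 2)) := by
      refine Tendsto.pow (Tendsto.const_mul x ?_) 2
      have h0 : Tendsto (fun n ↦ a n * x / 2) atTop (𝓝 0) := by
        simpa using (ha0.mul_const x).div_const 2
      simpa [Function.comp_def] using (Real.continuous_sinc.tendsto 0).comp h0
    rw [mul_one] at hs
    refine hs.congr fun n ↦ ?_
    rcases eq_or_ne x 0 with rfl | hx
    · simp [hf]
    · have hne : a n * x / 2 ≠ 0 := div_ne_zero (mul_ne_zero (hapos n).ne' hx) two_ne_zero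
      rw [Real.sinc_of_ne_zero hne, hf]
      have hcos : Real.cos (a n * x) = 1 - 2 * Real.sin (a n * x / 2) ^ 2 := by
        rw [Real.sin_sq_eq_half_sub, mul_div_cancel₀ _ two_ne_zero]
        ring
      simp only [hcos]
      have := (hapos n).ne'
      field_simp
      ring
  have hint (n) : Integrable (f n) μ := by
    refine Integrable.div_const ?_ _
    refine Integrable.of_bound (C := 4) (by fun_prop) (.of_forall fun x ↦ ?_)
    rw [Real.norm_eq_abs, abs_le]
    constructor <;> linarith [Real.cos_le_one (a n * x), Real.neg_one_le_cos (a n * x)]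
  have hbound : ∀ᶠ n in atTop, ∫⁻ x, ENNReal.ofReal (f n x) ∂μ ≤ ENNReal.ofReal C := by
    have h' : ∀ᶠ t in 𝓝 (0 : ℝ), charFun μ (-t) = g (-t) :=
      (show Tendsto (fun t : ℝ ↦ -t) (𝓝 0) (𝓝 0) by
        simpa using (continuous_neg (G := ℝ)).tendsto 0).eventually h
    filter_upwards [ha0.eventually h, ha0.eventually h'] with n hn hn'
    rw [← ofReal_integral_eq_lintegral_ofReal (hint n) (.of_forall (hf0 n))]
    refine ENNReal.ofReal_le_ofReal ?_
    simp only [hf]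
    rw [integral_div, integral_one_sub_cos_eq_charFun, div_le_iff₀ (by have := hapos n; positivity),
      hn, hn', h.self_of_nhds]
    refine (Complex.re_le_norm _).trans (hC _ ⟨(hapos n).le, ?_⟩)
    rw [ha]
    exact div_le_one_of_le₀ (by linarith [n.cast_nonneg (α := ℝ)]) (by positivity)
  -- Fatou's lemma turns the uniform bound on the integrals of `f n` into a bound on the second
  -- moment.
  have hfatou := lintegral_liminf_le (μ := μ) (u := atTop)
    (f := fun n x ↦ ENNReal.ofReal (f n x)) (fun n ↦ by fun_prop)
  have hle : ∫⁻ x, ENNReal.ofReal (x ^ 2) ∂μ ≤ ENNReal.ofReal C := by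
    refine le_trans (le_of_eq ?_) (hfatou.trans (liminf_le_of_frequently_le' hbound.frequently))
    congr with x
    exact ((ENNReal.tendsto_ofReal (hlim x)).liminf_eq).symm
  refine ⟨by fun_prop, ?_⟩
  rw [hasFiniteIntegral_iff_ofReal (.of_forall fun x ↦ sq_nonneg x)]
  exact hle.trans_lt ENNReal.ofReal_lt_top

theorem memLp_two_mul_of_integrable_pow {μ : Measure ℝ} {n : ℕ} (hi : Integrable (fun x ↦ x ^ (2 * n)) μ) :
    MemLp id ((2 * n : ℕ) : ENNReal) μ := by
  rcases Nat.eq_zero_or_pos n with rfl | hn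
  · simpa using (by fun_prop : AEStronglyMeasurable (id : ℝ → ℝ) μ)
  · rw [← integrable_norm_rpow_iff (by fun_prop)
      (by exact_mod_cast (by omega : 2 * n ≠ 0)) (ENNReal.natCast_ne_top _)]
    refine hi.congr (.of_forall fun x ↦ ?_)
    simp only
    rw [ENNReal.toReal_natCast, Real.rpow_natCast, id, Real.norm_eq_abs, pow_mul, pow_mul, sq_abs]

/-- If the characteristic function is smooth near `0`, then all moments are finite. -/
theorem integrable_pow_of_charFun_eventuallyEq {f : ℝ → ℂ} (hf : ContDiff ℝ ⊤ f)
    (h : charFun μ =ᶠ[𝓝 0] f) (n : ℕ) : Integrable (fun x ↦ x ^ (2 * n)) μ := by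
  induction n with
  | zero => simp
  | succ n ih =>
    -- Reweighting by `x ^ (2 * n)` gives a finite measure whose characteristic function is, up to
    -- sign, the derivative of order `2 * n`; its second moment is the next even moment of `μ`.
    set w : ℝ → ENNReal := fun x ↦ ENNReal.ofReal (x ^ (2 * n)) with hw
    have hwm : Measurable w := by fun_prop
    have hwt : ∀ᵐ x ∂μ, w x < ⊤ := .of_forall fun x ↦ ENNReal.ofReal_lt_top
    have hpos (x : ℝ) : 0 ≤ x ^ (2 * n) := (even_two_mul n).pow_nonneg x
    have hwr (x : ℝ) : (w x).toReal = x ^ (2 * n) := ENNReal.toReal_ofReal (hpos x)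
    have : IsFiniteMeasure (μ.withDensity w) :=
      isFiniteMeasure_withDensity_ofReal ih.hasFiniteIntegral
    have hmem := memLp_two_mul_of_integrable_pow ih
    have hchar : charFun (μ.withDensity w)
        =ᶠ[𝓝 0] fun t ↦ (-1) ^ n * iteratedDeriv (2 * n) f t := by
      filter_upwards [h.iteratedDeriv (2 * n)] with t ht
      rw [← ht, iteratedDeriv_charFun hmem, charFun_apply_real,
        integral_withDensity_eq_integral_toReal_smul hwm hwt, pow_mul, Complex.I_sq, ← mul_assoc,
        ← mul_pow]
      simp [hwr]
    have hd : ContDiff ℝ 2 fun t ↦ (-1) ^ n * iteratedDeriv (2 * n) f t := by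
      refine contDiff_const.mul ?_
      rw [iteratedDeriv_eq_iterate]
      exact ContDiff.iterate_deriv' 2 (2 * n) (hf.of_le le_top)
    have := integrable_sq_of_charFun_eventuallyEq hd hchar
    rw [integrable_withDensity_iff_integrable_smul' hwm hwt] at this
    refine this.congr (.of_forall fun x ↦ ?_)
    simp only [hwr, smul_eq_mul]
    ring

end Moments

/-! ### Entire characteristic functions and the cubic Marcinkiewicz theorem -/

section Entire

theorem iteratedDeriv_comp_ofReal {F : ℂ → ℂ} (hF : Differentiable ℂ F) (n : ℕ) :
    iteratedDeriv n (fun t : ℝ ↦ F t) = fun t : ℝ ↦ iteratedDeriv n F t := by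
  induction n with
  | zero => simp
  | succ n ih =>
    rw [iteratedDeriv_succ, ih, iteratedDeriv_succ]
    ext t
    have hd : Differentiable ℂ (iteratedDeriv n F) := by
      have : ContDiff ℂ (n + 1 : ℕ) F := hF.contDiff
      exact this.differentiable_iteratedDeriv n (by norm_cast; omega)
    exact (hd t).hasDerivAt.comp_ofReal.deriv

variable {μ : Measure ℝ} [IsFiniteMeasure μ]

/-- If the characteristic function is the restriction of an entire function near `0`, then all
exponential moments are finite. -/
theorem integrable_exp_of_charFun_eventuallyEq {F : ℂ → ℂ} (hF : Differentiable ℂ F)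
    (h : charFun μ =ᶠ[𝓝 0] fun t : ℝ ↦ F t) (r : ℝ) :
    Integrable (fun x ↦ Real.exp (r * x)) μ := by
  have hf : ContDiff ℝ ⊤ fun t : ℝ ↦ F t :=
    (hF.contDiff.restrict_scalars ℝ).comp Complex.ofRealCLM.contDiff
  have hint := integrable_pow_of_charFun_eventuallyEq hf h
  have hpos (n : ℕ) (x : ℝ) : 0 ≤ x ^ (2 * n) := (even_two_mul n).pow_nonneg x
  have hmom (n : ℕ) : ∫ x, x ^ (2 * n) ∂μ = ‖iteratedDeriv (2 * n) F 0‖ := by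
    have h1 := iteratedDeriv_charFun_zero (memLp_two_mul_of_integrable_pow (hint n))
    rw [h.iteratedDeriv_eq, iteratedDeriv_comp_ofReal hF] at h1
    have h2 : ‖iteratedDeriv (2 * n) F 0‖
        = ‖Complex.I ^ (2 * n) * ((∫ x, x ^ (2 * n) ∂μ : ℝ) : ℂ)‖ := by
      rw [← h1]; simp
    rw [h2, norm_mul, norm_pow, Complex.norm_I, one_pow, one_mul, Complex.norm_real,
      Real.norm_of_nonneg (integral_nonneg (hpos n))]
  -- Up to sign, these are the even terms of the Taylor series of the entire function `F` at `r`;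
  -- their sum is the integral of `cosh (r * x)`.
  have hsum : Summable fun n : ℕ ↦ r ^ (2 * n) / (2 * n).factorial * ∫ x, x ^ (2 * n) ∂μ := by
    have h1 := (Complex.hasSum_taylorSeries_of_entire hF 0 r).summable.norm
    have h2 := h1.comp_injective (i := fun n : ℕ ↦ 2 * n) (fun a b hab ↦ by simpa using hab)
    refine h2.congr fun n ↦ ?_
    simp only [Function.comp_apply, sub_zero, smul_eq_mul, norm_mul, norm_inv, norm_pow,
      Complex.norm_natCast, Complex.norm_real, hmom]
    rw [pow_mul ‖r‖, Real.norm_eq_abs, sq_abs, ← pow_mul]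
    ring
  have hcosh : Integrable (fun x ↦ Real.cosh (r * x)) μ := by
    refine ⟨by fun_prop, ?_⟩
    rw [hasFiniteIntegral_iff_ofReal (.of_forall fun x ↦ (Real.cosh_pos _).le)]
    have hterm (n : ℕ) (x : ℝ) : 0 ≤ (r * x) ^ (2 * n) / (2 * n).factorial :=
      div_nonneg (hpos n _) (by positivity)
    have he (x : ℝ) : ENNReal.ofReal (Real.cosh (r * x))
        = ∑' n : ℕ, ENNReal.ofReal ((r * x) ^ (2 * n) / (2 * n).factorial) := by
      rw [← ENNReal.ofReal_tsum_of_nonneg (fun n ↦ hterm n x) (Real.hasSum_cosh _).summable,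
        (Real.hasSum_cosh _).tsum_eq]
    simp_rw [he]
    rw [lintegral_tsum (fun n ↦ by fun_prop)]
    have hI (n : ℕ) : ∫⁻ x, ENNReal.ofReal ((r * x) ^ (2 * n) / (2 * n).factorial) ∂μ
        = ENNReal.ofReal (r ^ (2 * n) / (2 * n).factorial * ∫ x, x ^ (2 * n) ∂μ) := by
      have hfun : (fun x : ℝ ↦ (r * x) ^ (2 * n) / (2 * n).factorial)
          = fun x ↦ r ^ (2 * n) / (2 * n).factorial * x ^ (2 * n) := by
        ext x; ring
      rw [← integral_const_mul, ← ofReal_integral_eq_lintegral_ofReal _ (.of_forall (hterm n)),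
        hfun]
      rw [hfun]
      exact (hint n).const_mul _
    simp_rw [hI]
    rw [← ENNReal.ofReal_tsum_of_nonneg _ hsum]
    · exact ENNReal.ofReal_lt_top
    · exact fun n ↦ mul_nonneg (div_nonneg (hpos n r) (by positivity)) (integral_nonneg (hpos n))
  refine (hcosh.const_mul 2).mono' (by fun_prop) (.of_forall fun x ↦ ?_)
  rw [Real.norm_of_nonneg (Real.exp_pos _).le, Real.cosh_eq]
  linarith [Real.exp_pos (-(r * x))]

/-- If the characteristic function is the restriction of an entire function near `0`, then that
function is the Fourier-Laplace transform. -/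
theorem complexMGF_mul_I_eq_of_charFun_eventuallyEq {F : ℂ → ℂ} (hF : Differentiable ℂ F)
    (h : charFun μ =ᶠ[𝓝 0] fun t : ℝ ↦ F t) :
    (fun z : ℂ ↦ complexMGF id μ (z * Complex.I)) = F := by
  have huniv : integrableExpSet id μ = Set.univ :=
    Set.eq_univ_of_forall fun r ↦ integrable_exp_of_charFun_eventuallyEq hF h r
  have hM : AnalyticOnNhd ℂ (complexMGF id μ) Set.univ := by
    have := analyticOnNhd_complexMGF (X := id) (μ := μ)
    simpa [huniv] using this
  have hM' : AnalyticOnNhd ℂ (fun z : ℂ ↦ complexMGF id μ (z * Complex.I)) Set.univ :=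
    fun z _ ↦ (hM _ trivial).fun_comp (by fun_prop)
  refine hM'.eq_of_frequently_eq (z₀ := 0) (fun z _ ↦ hF.analyticAt z) ?_
  have ht : Tendsto (fun t : ℝ ↦ (t : ℂ)) (𝓝[≠] 0) (𝓝[≠] 0) := by
    refine tendsto_nhdsWithin_iff.2 ⟨?_, ?_⟩
    · have : Tendsto (fun t : ℝ ↦ (t : ℂ)) (𝓝 0) (𝓝 0) := by
        simpa using Complex.continuous_ofReal.tendsto 0
      exact this.mono_left nhdsWithin_le_nhds
    · filter_upwards [self_mem_nhdsWithin] with t ht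
      simpa using ht
  refine ht.frequently (Eventually.frequently ?_)
  filter_upwards [h.filter_mono nhdsWithin_le_nhds] with t ht
  rw [complexMGF_id_mul_I, ht]

/-- A cubic version of Marcinkiewicz's theorem: if the characteristic function is the exponential
of a cubic polynomial near `0`, then the distribution is gaussian. -/
theorem isGaussian_of_charFun_eventuallyEq_exp_cubic {μ : Measure ℝ} [IsProbabilityMeasure μ]
    {a b c : ℂ}
    (h : ∀ᶠ t : ℝ in 𝓝 0, charFun μ t = Complex.exp (a * t + b * t ^ 2 + c * t ^ 3)) :
    IsGaussian μ := by
  have hM := complexMGF_mul_I_eq_of_charFun_eventuallyEq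
    (F := fun z ↦ Complex.exp (a * z + b * z ^ 2 + c * z ^ 3)) (by fun_prop) h
  -- This is the logarithm of `|M (x + i y)| ≤ M x` for the moment generating function `M`,
  -- evaluated at `z = y - i x`.
  have hre (x y : ℝ) : (a * (y - x * Complex.I) + b * (y - x * Complex.I) ^ 2
      + c * (y - x * Complex.I) ^ 3).re ≤ (a * (-x * Complex.I) + b * (-x * Complex.I) ^ 2
      + c * (-x * Complex.I) ^ 3).re := by
    have h1 := congrFun hM (y - x * Complex.I)
    have h2 := congrFun hM (-x * Complex.I)
    have e1 : (y - x * Complex.I) * Complex.I = x + y * Complex.I := by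
      linear_combination (-x : ℂ) * Complex.I_sq
    have e2 : (-x * Complex.I) * Complex.I = x := by
      linear_combination (-x : ℂ) * Complex.I_sq
    simp only [e1, e2] at h1 h2
    have h3 := norm_complexMGF_le_mgf (X := id) (μ := μ) (z := x + y * Complex.I)
    rw [h1] at h3
    rw [complexMGF_ofReal] at h2
    have h4 := congrArg norm h2
    rw [Complex.norm_real, Real.norm_of_nonneg mgf_nonneg] at h4
    simp only [Complex.add_re, Complex.ofReal_re, Complex.mul_re, Complex.I_re, mul_zero,
      Complex.ofReal_im, Complex.I_im, mul_one, sub_self, add_zero] at h3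
    rw [h4, Complex.norm_exp, Complex.norm_exp] at h3
    simpa using Real.exp_le_exp.1 h3
  have hcub (x y : ℝ) : (a.re + 2 * b.im * x - 3 * c.re * x ^ 2) * y + (b.re + 3 * c.im * x) * y ^ 2
      + c.re * y ^ 3 ≤ 0 := by
    have := hre x y
    simp [pow_succ] at this
    linarith
  have hc (x : ℝ) := cubic_coeff_of_nonpos (hcub x)
  have hcre : c.re = 0 := (hc 0).2.2
  have hare : a.re = 0 := by simpa using (hc 0).1
  have hbre : b.re ≤ 0 := by simpa using (hc 0).2.1
  have hbim : b.im = 0 := by simpa [hcre, hare] using (hc 1).1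
  have hcim : c.im = 0 := by
    by_contra hne
    -- At this `x` the quadratic coefficient `b.re + 3 * c.im * x` equals 1, though it must be
    -- nonpositive.
    have := (hc ((-b.re + 1) / (3 * c.im))).2.1
    rw [mul_div_cancel₀ _ (mul_ne_zero three_ne_zero hne)] at this
    linarith
  have hc0 : c = 0 := Complex.ext hcre hcim
  have hμ : μ = gaussianReal a.im (-2 * b.re).toNNReal := by
    refine Measure.ext_of_charFun (funext fun t ↦ ?_)
    rw [charFun_gaussianReal, ← complexMGF_id_mul_I, congrFun hM t, hc0,
      Real.coe_toNNReal _ (by linarith)]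
    congr 1
    have ha : a = a.im * Complex.I := by apply Complex.ext <;> simp [hare]
    have hb : b = b.re := by apply Complex.ext <;> simp [hbim]
    conv_lhs => rw [ha, hb]
    push_cast
    ring
  rw [hμ]
  infer_instance

end Entire

/-! ### The functional equation for logarithms of characteristic functions -/

section FunctionalEquation

/-- Near `x` both arguments are below `π / 2` in absolute value, so their sum stays in the principal
branch. -/
theorem eventually_log_mul {X : Type*} [TopologicalSpace X] {x : X} {G H : X → ℂ}
    (hG : ContinuousAt G x) (hH : ContinuousAt H x) (hG1 : G x = 1) (hH1 : H x = 1) :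
    ∀ᶠ s in 𝓝 x, Complex.log (G s * H s) = Complex.log (G s) + Complex.log (H s) := by
  have aux {K : X → ℂ} (hK : ContinuousAt K x) (hK1 : K x = 1) :
      ∀ᶠ s in 𝓝 x, K s ≠ 0 ∧ |(K s).arg| < Real.pi / 2 := by
    refine (hK.eventually_ne (by simp [hK1])).and ?_
    have harg : ContinuousAt (fun s ↦ |(K s).arg|) x :=
      (ContinuousAt.comp (g := Complex.arg)
        (Complex.continuousAt_arg (by simp [hK1])) hK).abs
    exact harg.eventually_lt_const (by simp [hK1, Real.pi_pos])
  filter_upwards [aux hG hG1, aux hH hH1] with s ⟨hg, hg'⟩ ⟨hh, hh'⟩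
  rw [Complex.log_mul_eq_add_log_iff hg hh]
  rw [abs_lt] at hg' hh'
  constructor <;> linarith

variable {ι : Type*} [Fintype ι]

/-- If `f (s ⬝ᵥ α)` is a sum of four functions, each invariant along a direction that is not
orthogonal to `α`, then the fourth differences of `f` vanish. -/
theorem fourth_diff_eq_zero_of_sum_invariant {α : ι → ℝ} {u : Fin 4 → ι → ℝ}
    (hu : ∀ k, u k ⬝ᵥ α = 1) {f : ℝ → ℂ} {R : Fin 4 → (ι → ℝ) → ℂ}
    (hR : ∀ k s (h : ℝ), R k (s + h • u k) = R k s)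
    (hsum : ∀ᶠ s in 𝓝 (0 : ι → ℝ), f (s ⬝ᵥ α) = ∑ k, R k s) :
    ∀ᶠ p : ℝ × ℝ in 𝓝 0, f p.1 - 4 * f (p.1 + p.2) + 6 * f (p.1 + 2 * p.2)
      - 4 * f (p.1 + 3 * p.2) + f (p.1 + 4 * p.2) = 0 := by
  -- A cube with edges `p.2 • u k`: the vertex `e` has product `p.1 + |e| * p.2` with `α`, where
  -- `|e|` counts the true entries, and `R k` ignores the bit `e k`.
  set S : ℝ × ℝ → (Fin 4 → Bool) → ι → ℝ := fun p e ↦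
    p.1 • u 0 + ∑ k, (if e k then p.2 else 0) • u k with hS
  have hev : ∀ᶠ p in 𝓝 (0 : ℝ × ℝ), ∀ e, f (S p e ⬝ᵥ α) = ∑ k, R k (S p e) := by
    refine eventually_all.2 fun e ↦ ?_
    have hc : Continuous fun p ↦ S p e := by
      refine (continuous_fst.smul continuous_const).add
        (continuous_finsetSum _ fun k _ ↦ ?_)
      split_ifs <;> fun_prop
    have h0 : S 0 e = 0 := by simp [hS]
    have := hc.tendsto 0
    rw [h0] at this
    exact this.eventually hsum
  filter_upwards [hev] with p hp
  have hdot (e : Fin 4 → Bool) : S p e ⬝ᵥ α = p.1 + ∑ k, if e k then p.2 else 0 := by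
    simp only [hS, add_dotProduct, sum_dotProduct, smul_dotProduct, hu, smul_eq_mul, mul_one]
  have hinv (k : Fin 4) (e : Fin 4 → Bool) :
      R k (S p e) = R k (S p (Function.update e k false)) := by
    rw [← hR k (S p (Function.update e k false)) (if e k then p.2 else 0)]
    congr 1
    simp only [hS]
    rw [add_assoc]
    congr 1
    rw [← Finset.add_sum_erase _ _ (Finset.mem_univ k),
      ← Finset.add_sum_erase _ (fun j ↦ (if Function.update e k false j then p.2 else 0) • u j)
        (Finset.mem_univ k)]
    simp only [Function.update_self, Bool.false_eq_true, if_false, zero_smul, zero_add]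
    rw [add_comm]
    congr 1
    refine Finset.sum_congr rfl fun j hj ↦ ?_
    rw [Function.update_of_ne (Finset.ne_of_mem_erase hj)]
  have key (a b c d : Bool) :
      f (p.1 + ((if a then p.2 else 0) + (if b then p.2 else 0) + (if c then p.2 else 0)
        + (if d then p.2 else 0))) = R 0 (S p ![false, b, c, d]) + R 1 (S p ![a, false, c, d])
        + R 2 (S p ![a, b, false, d]) + R 3 (S p ![a, b, c, false]) := by
    have h1 := hp ![a, b, c, d]
    have e0 : Function.update ![a, b, c, d] 0 false = ![false, b, c, d] := by
      ext i; fin_cases i <;> rfl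
    have e1 : Function.update ![a, b, c, d] 1 false = ![a, false, c, d] := by
      ext i; fin_cases i <;> rfl
    have e2 : Function.update ![a, b, c, d] 2 false = ![a, b, false, d] := by
      ext i; fin_cases i <;> rfl
    have e3 : Function.update ![a, b, c, d] 3 false = ![a, b, c, false] := by
      ext i; fin_cases i <;> rfl
    rw [hdot, Fin.sum_univ_four, Fin.sum_univ_four, hinv 0, hinv 1, hinv 2, hinv 3, e0, e1, e2,
      e3] at h1
    exact h1
  have k0 := key false false false false
  have k1 := key true false false false
  have k2 := key false true false false
  have k3 := key false false true false
  have k4 := key false false false true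
  have k12 := key true true false false
  have k13 := key true false true false
  have k14 := key true false false true
  have k23 := key false true true false
  have k24 := key false true false true
  have k34 := key false false true true
  have k123 := key true true true false
  have k124 := key true true false true
  have k134 := key true false true true
  have k234 := key false true true true
  have k1234 := key true true true true
  have t2 : p.2 + p.2 = 2 * p.2 := by ring
  have t3 : 2 * p.2 + p.2 = 3 * p.2 := by ring
  have t4 : 3 * p.2 + p.2 = 4 * p.2 := by ring
  simp only [if_true, Bool.false_eq_true, if_false, add_zero, zero_add, t2, t3, t4] at *
  -- In the signed sum over the 16 vertices each `R k` cancels in pairs, while `f` collects the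
  -- weights 1, -4, 6, -4, 1.
  linear_combination k0 - k1 - k2 - k3 - k4 + k12 + k13 + k14 + k23 + k24 + k34
    - k123 - k124 - k134 - k234 + k1234

/-- If two factorizations of a function of several variables agree, where the first one contains
the factor `φ (s ⬝ᵥ α)` and all the other factors are invariant along one of four directions not
orthogonal to `α`, then `φ` is the exponential of a cubic polynomial near `0`. -/
theorem exists_eq_exp_cubic_of_mul_eq {α α' β : ι → ℝ} {φ φ' ψ ψ' : ℝ → ℂ}
    {A A' B B' : (ι → ℝ) → ℂ}
    (hφ : Continuous φ) (hφ' : Continuous φ') (hψ : Continuous ψ) (hψ' : Continuous ψ')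
    (hA : Continuous A) (hA' : Continuous A') (hB : Continuous B) (hB' : Continuous B')
    (φ0 : φ 0 = 1) (φ0' : φ' 0 = 1) (ψ0 : ψ 0 = 1) (ψ0' : ψ' 0 = 1)
    (A0 : A 0 = 1) (A0' : A' 0 = 1) (B0 : B 0 = 1) (B0' : B' 0 = 1)
    (heq : ∀ s, A s * (φ (s ⬝ᵥ α) * ψ (s ⬝ᵥ β)) * B s
      = A' s * (φ' (s ⬝ᵥ α') * ψ' (s ⬝ᵥ β)) * B' s)
    {u₀ u₁ u₂ u₃ : ι → ℝ}
    (h₀ : u₀ ⬝ᵥ α = 1) (h₁ : u₁ ⬝ᵥ α = 1) (h₂ : u₂ ⬝ᵥ α = 1) (h₃ : u₃ ⬝ᵥ α = 1)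
    (iB : ∀ s (h : ℝ), B (s + h • u₀) = B s) (iB' : ∀ s (h : ℝ), B' (s + h • u₀) = B' s)
    (iA : ∀ s (h : ℝ), A (s + h • u₁) = A s) (iA' : ∀ s (h : ℝ), A' (s + h • u₁) = A' s)
    (oβ : u₂ ⬝ᵥ β = 0) (oα' : u₃ ⬝ᵥ α' = 0) :
    ∃ a b c : ℂ, ∀ᶠ t : ℝ in 𝓝 0, φ t = Complex.exp (a * t + b * t ^ 2 + c * t ^ 3) := by
  have hd (γ : ι → ℝ) : Continuous fun s : ι → ℝ ↦ s ⬝ᵥ γ := by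
    simp only [dotProduct]; fun_prop
  have expand {φ ψ : ℝ → ℂ} {α : ι → ℝ} {A B : (ι → ℝ) → ℂ} (hφ : Continuous φ)
      (hψ : Continuous ψ) (hA : Continuous A) (hB : Continuous B) (φ0 : φ 0 = 1) (ψ0 : ψ 0 = 1)
      (A0 : A 0 = 1) (B0 : B 0 = 1) : ∀ᶠ s in 𝓝 (0 : ι → ℝ),
      Complex.log (A s * (φ (s ⬝ᵥ α) * ψ (s ⬝ᵥ β)) * B s) = Complex.log (A s)
        + (Complex.log (φ (s ⬝ᵥ α)) + Complex.log (ψ (s ⬝ᵥ β))) + Complex.log (B s) := by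
    have c1 := hφ.comp (hd α)
    have c2 := hψ.comp (hd β)
    have e1 := eventually_log_mul (x := 0) c1.continuousAt c2.continuousAt (by simp [φ0])
      (by simp [ψ0])
    have e2 := eventually_log_mul (x := 0) hA.continuousAt (c1.mul c2).continuousAt A0
      (by simp [φ0, ψ0])
    have e3 := eventually_log_mul (x := 0) (hA.mul (c1.mul c2)).continuousAt hB.continuousAt
      (by simp [A0, φ0, ψ0]) B0
    filter_upwards [e1, e2, e3] with s e1 e2 e3
    simp only [Function.comp_apply, Pi.mul_apply] at e1 e2 e3
    rw [e3, e2, e1]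
  have hsum : ∀ᶠ s in 𝓝 (0 : ι → ℝ), Complex.log (φ (s ⬝ᵥ α)) = ∑ k, (![
      fun s ↦ Complex.log (B' s) - Complex.log (B s),
      fun s ↦ Complex.log (A' s) - Complex.log (A s),
      fun s ↦ Complex.log (ψ' (s ⬝ᵥ β)) - Complex.log (ψ (s ⬝ᵥ β)),
      fun s ↦ Complex.log (φ' (s ⬝ᵥ α'))] : Fin 4 → (ι → ℝ) → ℂ) k s := by
    filter_upwards [expand (α := α) hφ hψ hA hB φ0 ψ0 A0 B0,
      expand (α := α') hφ' hψ' hA' hB' φ0' ψ0' A0' B0'] with s h h'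
    rw [heq s, h'] at h
    simp only [Fin.sum_univ_four, Matrix.cons_val]
    linear_combination -h
  have hdiff := fourth_diff_eq_zero_of_sum_invariant (α := α) (u := ![u₀, u₁, u₂, u₃])
    (f := fun t ↦ Complex.log (φ t))
    (fun k ↦ by fin_cases k <;> simp [h₀, h₁, h₂, h₃])
    (fun k s h ↦ by
      fin_cases k <;> simp [iA, iA', iB, iB', add_dotProduct, smul_dotProduct, oβ, oα']) hsum
  have hne : ∀ᶠ t in 𝓝 0, φ t ∈ Complex.slitPlane :=
    hφ.continuousAt.eventually_mem (Complex.isOpen_slitPlane.mem_nhds (by simp [φ0]))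
  obtain ⟨a, b, c, habc⟩ := exists_cubic_of_fourth_diff_eq_zero (by simp [φ0])
    (hne.mono fun t ht ↦ hφ.continuousAt.clog ht) hdiff
  refine ⟨a, b, c, ?_⟩
  filter_upwards [habc, hne] with t ht hn
  rw [← ht, Complex.exp_log (Complex.slitPlane_ne_zero hn)]

end FunctionalEquation

/-! ### Factorization by dates in the earnings model -/

namespace EDModel

variable {q T : ℕ}

/-- The coefficients of `ξ_t` in `y_1, …, y_T`. -/
def xiWeight (M : EDModel q T) (t : ℤ) (i : Fin T) : ℝ :=
  -- The guard matters: for later `t`, `toNat` would truncate to 0 and return the coefficient 1.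
  if t ≤ i + 1 then M.coeff ((i : ℤ) + 1 - t).toNat else 0

/-- The coefficients of `η_t`, `1 ≤ t`, in `y_1, …, y_T`. -/
def etaWeight (t : ℤ) (i : Fin T) : ℝ :=
  if t ≤ i + 1 then 1 else 0

/-- The contribution of the shocks of time `t` to the characteristic function of `(y_1, …, y_T)`. -/
noncomputable def blockCharFun (M : EDModel q T) (t : ℤ) (s : Fin T → ℝ) : ℂ :=
  ∫ ω, Complex.exp (((s ⬝ᵥ M.xiWeight t * M.ξ t ω
    + s ⬝ᵥ etaWeight t * (if 1 ≤ t then M.η t ω else 0) : ℝ) : ℂ) * Complex.I) ∂M.P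

theorem coeff_eq_zero (M : EDModel q T) {j : ℕ} (hj : q < j) : M.coeff j = 0 := by
  cases j with
  | zero => omega
  | succ j => simp only [coeff]; rw [dif_neg (by omega)]

theorem xiWeight_one (M : EDModel q T) (i : Fin T) : M.xiWeight 1 i = M.coeff i := by
  simp [xiWeight]

theorem etaWeight_one (i : Fin T) : etaWeight 1 i = 1 := by
  simp [etaWeight]

theorem permanent_eq_sum (M : EDModel q T) (i : Fin T) (ω : M.Ω) :
    M.permanent ((i : ℤ) + 1) ω = ∑ t ∈ Finset.Icc (1 - (q : ℤ)) T,
      etaWeight t i * (if 1 ≤ t then M.η t ω else 0) := by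
  rw [permanent]
  have hsub : Finset.Icc (1 : ℤ) ((i : ℤ) + 1) ⊆ Finset.Icc (1 - (q : ℤ)) T := by
    intro t ht
    simp only [Finset.mem_Icc] at ht ⊢
    omega
  rw [← Finset.sum_subset hsub]
  · refine Finset.sum_congr rfl fun t ht ↦ ?_
    simp only [Finset.mem_Icc] at ht
    simp [etaWeight, ht.1, ht.2]
  · intro t _ ht
    simp only [Finset.mem_Icc, not_and] at ht
    by_cases h1 : 1 ≤ t
    · simp [etaWeight, ht h1]
    · simp [h1]

theorem transitory_eq_sum (M : EDModel q T) (i : Fin T) (ω : M.Ω) :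
    M.transitory ((i : ℤ) + 1) ω = ∑ t ∈ Finset.Icc (1 - (q : ℤ)) T,
      M.xiWeight t i * M.ξ t ω := by
  have hsub : Finset.Icc ((i : ℤ) + 1 - q) ((i : ℤ) + 1) ⊆ Finset.Icc (1 - (q : ℤ)) T := by
    intro t ht
    simp only [Finset.mem_Icc] at ht ⊢
    omega
  rw [transitory, ← Finset.sum_subset hsub]
  · refine Finset.sum_bij' (fun j _ ↦ (i : ℤ) + 1 - j) (fun t _ ↦ ((i : ℤ) + 1 - t).toNat)
      ?_ ?_ ?_ ?_ ?_
    · intro j hj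
      simp only [Finset.mem_range, Finset.mem_Icc] at hj ⊢
      omega
    · intro t ht
      simp only [Finset.mem_range, Finset.mem_Icc] at ht ⊢
      omega
    · intro j hj
      simp
    · intro t ht
      simp only [Finset.mem_Icc] at ht
      omega
    · intro j hj
      simp [xiWeight]
  · intro t _ ht
    simp only [Finset.mem_Icc, not_and] at ht
    rw [xiWeight]
    split_ifs with h
    · rw [M.coeff_eq_zero (by omega), zero_mul]
    · simp

theorem sum_mul_income (M : EDModel q T) (s : Fin T → ℝ) (ω : M.Ω) :
    ∑ i : Fin T, s i * M.income ((i : ℤ) + 1) ω = ∑ t ∈ Finset.Icc (1 - (q : ℤ)) T,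
      (s ⬝ᵥ M.xiWeight t * M.ξ t ω + s ⬝ᵥ etaWeight t * (if 1 ≤ t then M.η t ω else 0)) := by
  simp only [income, permanent_eq_sum, transitory_eq_sum, ← Finset.sum_add_distrib,
    Finset.mul_sum, dotProduct, Finset.sum_mul]
  rw [Finset.sum_comm]
  refine Finset.sum_congr rfl fun t _ ↦ Finset.sum_congr rfl fun i _ ↦ ?_
  ring

theorem measurable_block (M : EDModel q T) {t : ℤ} (ht : t ∈ Finset.Icc (1 - (q : ℤ)) T) :
    Measurable fun ω ↦ ((M.ξ t ω, if 1 ≤ t then M.η t ω else 0) : ℝ × ℝ) := by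
  refine (M.measurable_ξ t ht).prodMk ?_
  split_ifs with h
  · exact M.measurable_η t (by simp only [Finset.mem_Icc] at ht ⊢; exact ⟨h, ht.2⟩)
  · exact measurable_const

theorem measurable_income (M : EDModel q T) (i : Fin T) :
    Measurable (M.income ((i : ℤ) + 1)) := by
  have : M.income ((i : ℤ) + 1) = fun ω ↦
      ∑ t ∈ Finset.Icc (1 - (q : ℤ)) T, etaWeight t i * (if 1 ≤ t then M.η t ω else 0)
      + ∑ t ∈ Finset.Icc (1 - (q : ℤ)) T, M.xiWeight t i * M.ξ t ω := by
    ext ω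
    rw [income, permanent_eq_sum, transitory_eq_sum]
  rw [this]
  exact (Finset.measurable_fun_sum _ fun t ht ↦ (M.measurable_block ht).snd.const_mul _).add
    (Finset.measurable_fun_sum _ fun t ht ↦ (M.measurable_block ht).fst.const_mul _)

theorem integral_exp_observedLaw (M : EDModel q T) (s : Fin T → ℝ) :
    ∫ y, Complex.exp (((∑ i, s i * y i : ℝ) : ℂ) * Complex.I) ∂M.observedLaw
      = ∏ t ∈ Finset.Icc (1 - (q : ℤ)) T, M.blockCharFun t s := by
  rw [observedLaw, integral_map (measurable_pi_lambda _ M.measurable_income).aemeasurable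
    (Continuous.aestronglyMeasurable (by fun_prop))]
  simp only [sum_mul_income, Complex.ofReal_sum, Finset.sum_mul, Complex.exp_sum]
  simp only [← Finset.prod_coe_sort (Finset.Icc (1 - (q : ℤ)) (T : ℤ))]
  exact M.indep.integral_fun_prod_comp
    (f := fun (t : Finset.Icc (1 - (q : ℤ)) (T : ℤ)) p ↦ Complex.exp (((s ⬝ᵥ M.xiWeight t * p.1
      + s ⬝ᵥ etaWeight t * p.2 : ℝ) : ℂ) * Complex.I))
    (fun t ↦ (M.measurable_block t.2).aemeasurable) (fun t ↦ Continuous.aestronglyMeasurable (by fun_prop))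

theorem continuous_blockCharFun (M : EDModel q T) {t : ℤ}
    (ht : t ∈ Finset.Icc (1 - (q : ℤ)) T) : Continuous (M.blockCharFun t) := by
  have hm := M.measurable_block ht
  refine continuous_of_dominated (bound := fun _ ↦ 1) (fun s ↦ ?_) (fun s ↦ ?_)
    (integrable_const _) (.of_forall fun ω ↦ ?_)
  · exact Measurable.aestronglyMeasurable <| Complex.measurable_exp.comp
      ((Complex.measurable_ofReal.comp
        ((hm.fst.const_mul _).add (hm.snd.const_mul _))).mul_const _)
  · exact .of_forall fun ω ↦ (Complex.norm_exp_ofReal_mul_I _).le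
  · simp only [dotProduct]
    fun_prop

theorem blockCharFun_zero (M : EDModel q T) (t : ℤ) : M.blockCharFun t 0 = 1 := by
  simp [blockCharFun]

theorem blockCharFun_add_smul (M : EDModel q T) {t : ℤ} {u : Fin T → ℝ}
    (hξ : u ⬝ᵥ M.xiWeight t = 0) (hη : 1 ≤ t → u ⬝ᵥ etaWeight t = 0) (s : Fin T → ℝ) (h : ℝ) :
    M.blockCharFun t (s + h • u) = M.blockCharFun t s := by
  simp only [blockCharFun, add_dotProduct, smul_dotProduct, hξ, smul_zero, add_zero]
  split_ifs with ht
  · simp [hη ht]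
  · simp

/-- Independence of `η_1` and `ξ_1` enters here, splitting the date 1 factor. -/
theorem blockCharFun_one (M : EDModel q T) (hT : 1 ≤ T) (hind : IndepFun (M.η 1) (M.ξ 1) M.P)
    (s : Fin T → ℝ) : M.blockCharFun 1 s = charFun (M.P.map (M.ξ 1)) (s ⬝ᵥ M.xiWeight 1)
      * charFun (M.P.map (M.η 1)) (s ⬝ᵥ etaWeight 1) := by
  have hξ : Measurable (M.ξ 1) := M.measurable_ξ 1 (by simp only [Finset.mem_Icc]; omega)
  have hη : Measurable (M.η 1) := M.measurable_η 1 (by simp only [Finset.mem_Icc]; omega)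
  rw [charFun_apply_real, charFun_apply_real, integral_map hξ.aemeasurable (by fun_prop),
    integral_map hη.aemeasurable (by fun_prop)]
  have := hind.symm.integral_fun_comp_mul_comp (μ := M.P)
    (f := fun x : ℝ ↦ Complex.exp ((s ⬝ᵥ M.xiWeight 1 : ℝ) * x * Complex.I))
    (g := fun x : ℝ ↦ Complex.exp ((s ⬝ᵥ etaWeight 1 : ℝ) * x * Complex.I))
    hξ.aemeasurable hη.aemeasurable (by fun_prop) (by fun_prop)
  rw [← this, blockCharFun]
  congr with ω
  rw [← Complex.exp_add]
  push_cast
  ring_nf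

theorem prod_blockCharFun (M : EDModel q T) (hT : 1 ≤ T) (hind : IndepFun (M.η 1) (M.ξ 1) M.P)
    (s : Fin T → ℝ) : ∏ t ∈ Finset.Icc (1 - (q : ℤ)) T, M.blockCharFun t s
      = (∏ t ∈ Finset.Icc (1 - (q : ℤ)) 0, M.blockCharFun t s)
        * (charFun (M.P.map (M.ξ 1)) (s ⬝ᵥ M.xiWeight 1)
          * charFun (M.P.map (M.η 1)) (s ⬝ᵥ etaWeight 1))
        * ∏ t ∈ Finset.Icc (2 : ℤ) T, M.blockCharFun t s := by
  have h1 : Finset.Icc (1 - (q : ℤ)) T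
      = (Finset.Icc (1 - (q : ℤ)) 0 ∪ {1}) ∪ Finset.Icc (2 : ℤ) T := by
    ext t
    simp only [Finset.mem_union, Finset.mem_Icc, Finset.mem_singleton]
    omega
  rw [h1, Finset.prod_union, Finset.prod_union, Finset.prod_singleton, M.blockCharFun_one hT hind]
  · rw [Finset.disjoint_left]
    intro t
    simp only [Finset.mem_Icc, Finset.mem_singleton]
    omega
  · rw [Finset.disjoint_left]
    intro t
    simp only [Finset.mem_union, Finset.mem_Icc, Finset.mem_singleton]
    omega

theorem single_first_dotProduct_xiWeight (M : EDModel q T) (hT : 1 ≤ T) {t : ℤ}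
    (ht : t ∈ Finset.Icc (2 : ℤ) T) :
    Pi.single (⟨0, by omega⟩ : Fin T) (1 : ℝ) ⬝ᵥ M.xiWeight t = 0 := by
  rw [Finset.mem_Icc] at ht
  rw [single_dotProduct, xiWeight, if_neg (by push_cast; omega), mul_zero]

theorem single_first_dotProduct_etaWeight (hT : 1 ≤ T) {t : ℤ}
    (ht : t ∈ Finset.Icc (2 : ℤ) T) :
    Pi.single (⟨0, by omega⟩ : Fin T) (1 : ℝ) ⬝ᵥ etaWeight t = 0 := by
  rw [Finset.mem_Icc] at ht
  rw [single_dotProduct, etaWeight, if_neg (by push_cast; omega), mul_zero]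

/-- The zero-based index `q` is period `q + 1`, where shocks dated at most 0 have lag beyond `q`.
This is why `q + 1` periods are required. -/
theorem single_last_dotProduct_xiWeight (M : EDModel q T) (hT : q + 1 ≤ T) {t : ℤ}
    (ht : t ∈ Finset.Icc (1 - (q : ℤ)) 0) :
    Pi.single (⟨q, by omega⟩ : Fin T) (1 : ℝ) ⬝ᵥ M.xiWeight t = 0 := by
  rw [Finset.mem_Icc] at ht
  rw [single_dotProduct, xiWeight, if_pos (by push_cast; omega),
    M.coeff_eq_zero (by push_cast; omega), mul_zero]

/-- If two observationally equivalent models load differently on `ξ_1`, and the loadings of the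
first model on `ξ_1` differ from those on `η_1`, then `ξ_1` is gaussian in the first model. -/
theorem hasGaussianLaw_of_xiWeight_ne (hT : q + 1 ≤ T) (M : EDModel.{u} q T) (N : EDModel.{v} q T)
    (hM : IndepFun (M.η 1) (M.ξ 1) M.P) (hN : IndepFun (N.η 1) (N.ξ 1) N.P)
    (hq : M.coeff q ≠ 0) (heq : M.observedLaw = N.observedLaw) {i j : Fin T}
    (hi : M.xiWeight 1 i ≠ N.xiWeight 1 i) (hj : M.xiWeight 1 j ≠ 1) :
    HasGaussianLaw (M.ξ 1) M.P := by
  have hT1 : 1 ≤ T := by omega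
  have hξ : Measurable (M.ξ 1) := M.measurable_ξ 1 (by simp only [Finset.mem_Icc]; omega)
  have hη : Measurable (M.η 1) := M.measurable_η 1 (by simp only [Finset.mem_Icc]; omega)
  have hξ' : Measurable (N.ξ 1) := N.measurable_ξ 1 (by simp only [Finset.mem_Icc]; omega)
  have hη' : Measurable (N.η 1) := N.measurable_η 1 (by simp only [Finset.mem_Icc]; omega)
  have := Measure.isProbabilityMeasure_map (μ := M.P) hξ.aemeasurable
  have := Measure.isProbabilityMeasure_map (μ := M.P) hη.aemeasurable
  have := Measure.isProbabilityMeasure_map (μ := N.P) hξ'.aemeasurable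
  have := Measure.isProbabilityMeasure_map (μ := N.P) hη'.aemeasurable
  let o : Fin T := ⟨0, by omega⟩
  let l : Fin T := ⟨q, by omega⟩
  have ho (K : EDModel.{u} q T) : K.xiWeight 1 o = 1 := by rw [xiWeight_one]; rfl
  have ho' (K : EDModel.{v} q T) : K.xiWeight 1 o = 1 := by rw [xiWeight_one]; rfl
  have hl : M.xiWeight 1 l = M.coeff q := M.xiWeight_one l
  have cont {a b : ℤ} (ha : 1 - (q : ℤ) ≤ a) (hb : b ≤ T) :
      Continuous (fun s ↦ ∏ t ∈ Finset.Icc a b, M.blockCharFun t s) ∧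
      Continuous (fun s ↦ ∏ t ∈ Finset.Icc a b, N.blockCharFun t s) := by
    constructor <;> refine continuous_finsetProd _ fun t ht ↦ continuous_blockCharFun _ ?_ <;>
    · simp only [Finset.mem_Icc] at ht ⊢
      omega
  -- All directions are scaled to have product 1 with `α`: `u₀` removes dates at least 2, `u₁` dates
  -- at most 0 (using `a_q ≠ 0`), `u₂` is orthogonal to `β`, and `u₃` to `α'`.
  obtain ⟨a, b, c, h⟩ := exists_eq_exp_cubic_of_mul_eq
    (α := M.xiWeight 1) (α' := N.xiWeight 1) (β := etaWeight 1)
    (u₀ := Pi.single o 1) (u₁ := (M.coeff q)⁻¹ • Pi.single l 1)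
    (u₂ := (M.xiWeight 1 j - 1)⁻¹ • (Pi.single j 1 - Pi.single o 1))
    (u₃ := (M.xiWeight 1 i - N.xiWeight 1 i)⁻¹ • (Pi.single i 1 - N.xiWeight 1 i • Pi.single o 1))
    (continuous_charFun (μ := M.P.map (M.ξ 1))) (continuous_charFun (μ := N.P.map (N.ξ 1)))
    (continuous_charFun (μ := M.P.map (M.η 1))) (continuous_charFun (μ := N.P.map (N.η 1)))
    (cont (b := 0) le_rfl (by omega)).1 (cont (b := 0) le_rfl (by omega)).2
    (cont (a := 2) (by omega) le_rfl).1 (cont (a := 2) (by omega) le_rfl).2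
    (by simp) (by simp) (by simp) (by simp)
    (by simp [blockCharFun_zero]) (by simp [blockCharFun_zero])
    (by simp [blockCharFun_zero]) (by simp [blockCharFun_zero])
    (fun s ↦ by
      rw [← M.prod_blockCharFun hT1 hM, ← N.prod_blockCharFun hT1 hN, ← integral_exp_observedLaw,
        ← integral_exp_observedLaw, heq])
    (by simp [single_dotProduct, ho])
    (by simp [smul_dotProduct, single_dotProduct, hl, hq])
    (by simp [smul_dotProduct, sub_dotProduct, single_dotProduct, ho, sub_ne_zero.2 hj])
    (by simp [smul_dotProduct, sub_dotProduct, single_dotProduct, ho, sub_ne_zero.2 hi])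
    (fun s h ↦ Finset.prod_congr rfl fun t ht ↦
      M.blockCharFun_add_smul (M.single_first_dotProduct_xiWeight hT1 ht)
        (fun _ ↦ single_first_dotProduct_etaWeight hT1 ht) s h)
    (fun s h ↦ Finset.prod_congr rfl fun t ht ↦
      N.blockCharFun_add_smul (N.single_first_dotProduct_xiWeight hT1 ht)
        (fun _ ↦ single_first_dotProduct_etaWeight hT1 ht) s h)
    (fun s h ↦ Finset.prod_congr rfl fun t ht ↦
      M.blockCharFun_add_smul
        (by rw [smul_dotProduct, M.single_last_dotProduct_xiWeight hT ht, smul_zero])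
        (fun h1 ↦ absurd h1 (by simp only [Finset.mem_Icc] at ht; omega)) s h)
    (fun s h ↦ Finset.prod_congr rfl fun t ht ↦
      N.blockCharFun_add_smul
        (by rw [smul_dotProduct, N.single_last_dotProduct_xiWeight hT ht, smul_zero])
        (fun h1 ↦ absurd h1 (by simp only [Finset.mem_Icc] at ht; omega)) s h)
    (by simp [smul_dotProduct, sub_dotProduct, single_dotProduct, etaWeight_one])
    (by simp [smul_dotProduct, sub_dotProduct, single_dotProduct, ho'])
  exact ⟨isGaussian_of_charFun_eventuallyEq_exp_cubic h⟩

end EDModel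

theorem lemma1 {q T : ℕ} (hT : q + 1 ≤ T) (M : EDModel.{u} q T)
    (hind : IndepFun (M.η 1) (M.ξ 1) M.P)
    (hng : ¬ HasGaussianLaw (M.ξ 1) M.P)
    (haq : M.coeff q ≠ 0) :
    EDModel.CoeffsIdentified.{u, v} M := by
  intro N hN heq j
  by_contra hne
  let i : Fin T := ⟨j + 1, by omega⟩
  have hMi : M.xiWeight 1 i = M.a j := by
    rw [EDModel.xiWeight_one]
    simp [i, EDModel.coeff]
  have hNi : N.xiWeight 1 i = N.a j := by
    rw [EDModel.xiWeight_one]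
    simp [i, EDModel.coeff]
  -- If the loading in `M` is 1, the one in `N` is not, so the roles are exchanged and
  -- nongaussianity in `N` is contradicted.
  by_cases h1 : M.xiWeight 1 i = 1
  · refine hN.nongaussian (EDModel.hasGaussianLaw_of_xiWeight_ne hT N M hN.indepFun hind
      hN.coeff_ne_zero heq.symm (i := i) (j := i) ?_ ?_)
    · rwa [hMi, hNi]
    · rwa [← h1, hMi, hNi]
  · refine hng (EDModel.hasGaussianLaw_of_xiWeight_ne hT M N hind hN.indepFun haq heq
      (i := i) (j := i) ?_ h1)
    rw [hMi, hNi]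
    exact Ne.symm hne
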